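/- Let $G$ be a finite simple graph, let $K$ be a field, and let $S = K[x_v : v \in V(G)]$. For an edge $e=\{v,w\}$ put $x_e = x_v x_w$. A $k$-matching of $G$ is a set $M$ of $k$ pairwise disjoint edges of $G$; put $x_M = \prod_{e \in M} x_e$. The $k$th squarefree power of the edge ideal $I(G)$ is the ideal $I(G)^{[k]} = (x_M : M \text{ is a } k\text{-matching of } G)$ of $S$. An ideal $I \subset S$ generated by forms of a single degree is called linearly related if the first syzygy module of $I$ (with respect to a minimal system of homogeneous generators) is generated by linear relations, that is, by syzygies whose coordinates are linear forms or zero. It has a linear resolution if, for some $t$, it has a graded free resolution $\cdots \to S(-t-2)^{b_2} \to S(-t-1)^{b_1} \to S(-t)^{b_0} \to I \to 0$. **Lemma 2.2.** Let $1 \le d < c$ be integers. Let $H$ be a graph on $c$ vertices that is the disjoint union of a complete graph $K_{c-d}$ and $d$ isolated vertices. Let $G$ be the graph obtained from $H$ by adding a whisker to each vertex of $H$, that is, by adding for each vertex $v$ of $H$ a new vertex whose only neighbour is $v$. Then $I(G)^{[c-1]}$ is not linearly related, and it does not have a linear resolution. -/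

import Mathlib

open MvPolynomial

namespace SimpleGraph

/-- The graph obtained from `H` by adding a whisker to each vertex: the vertices of `H` are
`Sum.inl a`, and `Sum.inr a` is a new vertex joined to `Sum.inl a` only. -/
def whiskering {V : Type*} (H : SimpleGraph V) : SimpleGraph (V ⊕ V) where
  Adj
    | Sum.inl a, Sum.inl b => H.Adj a b
    | Sum.inl a, Sum.inr b => a = b
    | Sum.inr a, Sum.inl b => a = b
    | Sum.inr _, Sum.inr _ => False
  symm := ⟨by
    rintro (a | a) (b | b) h
    · exact H.adj_symm h
    · exact h.symm
    · exact h.symm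
    · exact h⟩
  loopless := ⟨by
    rintro (a | a) h
    · exact H.irrefl h
    · exact h⟩

/-- `M` is a `k`-matching of `G`: a set of `k` pairwise disjoint edges of `G`. -/
structure IsKMatching {W : Type*} (G : SimpleGraph W) (k : ℕ) (M : Finset (Sym2 W)) : Prop where
  isEdge : ∀ e ∈ M, e ∈ G.edgeSet
  disjoint : ∀ e ∈ M, ∀ e' ∈ M, e ≠ e' → ∀ v, v ∈ e → v ∉ e'
  card_eq : M.card = k

end SimpleGraph

/-- The monomial `x_e = x_i x_j` of an edge `e = {i, j}`. -/
noncomputable def edgeMonomial (K : Type*) [CommSemiring K] {W : Type*} (e : Sym2 W) :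
    MvPolynomial W K :=
  Sym2.lift ⟨fun i j => X i * X j, fun i j => mul_comm (X i) (X j)⟩ e

/-- The monomial `x_M`, the product of the `x_e` over the edges `e` in `M`. -/
noncomputable def matchingMonomial (K : Type*) [CommSemiring K] {W : Type*}
    (M : Finset (Sym2 W)) : MvPolynomial W K :=
  ∏ e ∈ M, edgeMonomial K e

/-- The squarefree power `I(G)^[k]` of the edge ideal of `G`: the ideal of `K[x_w : w ∈ W]`
generated by the monomials `x_M`, where `M` is a `k`-matching of `G`. -/
noncomputable def squarefreePower (K : Type*) [CommSemiring K] {W : Type*} (G : SimpleGraph W)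
    (k : ℕ) : Ideal (MvPolynomial W K) :=
  Ideal.span {m | ∃ M : Finset (Sym2 W), G.IsKMatching k M ∧ m = matchingMonomial K M}

/-- The first syzygy module of the family `f`: all `r` with `∑ i, r i * f i = 0`. -/
noncomputable def syzygyModule {K : Type*} [CommSemiring K] {W : Type*} {b : ℕ}
    (f : Fin b → MvPolynomial W K) :
    Submodule (MvPolynomial W K) (Fin b → MvPolynomial W K) :=
  LinearMap.ker (Fintype.linearCombination (MvPolynomial W K) f)

/-- `I` is linearly related: `I` is generated by forms of one common degree `t`, and for a minimal
system `f` of such generators the first syzygy module is generated by linear relations, that is, by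
syzygies all of whose coordinates are linear forms (or zero). For forms of the same degree, minimality
means linear independence over the field `K`. -/
def IsLinearlyRelated {K : Type*} [Field K] {W : Type*} (I : Ideal (MvPolynomial W K)) : Prop :=
  ∃ (t b : ℕ) (f : Fin b → MvPolynomial W K),
    (∀ i, (f i).IsHomogeneous t) ∧ LinearIndependent K f ∧ Ideal.span (Set.range f) = I ∧
    Submodule.span (MvPolynomial W K) {r | r ∈ syzygyModule f ∧ ∀ i, (r i).IsHomogeneous 1} =
      syzygyModule f

/-- `I` has a linear resolution: for some `t` there is a graded free resolution
`⋯ → S(-t-2)^(b 2) → S(-t-1)^(b 1) → S(-t)^(b 0) → I → 0` over `S = K[x_w : w ∈ W]`.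
The augmentation is given by generators `f` of degree `t`, and the differentials by matrices
`A n`, whose entries are then linear forms (or zero). Such a resolution is automatically minimal. -/
def HasLinearResolution {K : Type*} [Field K] {W : Type*} (I : Ideal (MvPolynomial W K)) : Prop :=
  ∃ (t : ℕ) (b : ℕ → ℕ) (f : Fin (b 0) → MvPolynomial W K)
    (A : (n : ℕ) → Matrix (Fin (b n)) (Fin (b (n + 1))) (MvPolynomial W K)),
    (∀ i, (f i).IsHomogeneous t) ∧ (∀ n i j, (A n i j).IsHomogeneous 1) ∧
    Ideal.span (Set.range f) = I ∧
    Function.Exact (A 0).mulVecLin (Fintype.linearCombination (MvPolynomial W K) f) ∧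
    ∀ n, Function.Exact (A (n + 1)).mulVecLin (A n).mulVecLin

open Finsupp in
/-- A monomial exponent of degree one is the exponent of a variable. -/
theorem Finsupp.exists_eq_single_of_degree_eq_one {W : Type*} {n : W →₀ ℕ} (h : n.degree = 1) :
    ∃ j, n = single j 1 := by
  have hn : n ≠ 0 := by rintro rfl; simp at h
  obtain ⟨j, hj⟩ := Finsupp.ne_iff.1 hn
  have hle : single j 1 ≤ n := by
    rw [Finsupp.single_le_iff]; exact Nat.one_le_iff_ne_zero.2 hj
  obtain ⟨k, rfl⟩ := exists_add_of_le hle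
  refine ⟨j, ?_⟩
  have hk : k.degree = 0 := by
    rw [map_add, Finsupp.degree_single] at h; omega
  rw [Finsupp.degree_eq_zero_iff] at hk
  rw [hk, add_zero]

theorem Finsupp.eq_of_le_of_degree_le {W : Type*} {a n : W →₀ ℕ} (h : a ≤ n)
    (hd : n.degree ≤ a.degree) : a = n := by
  obtain ⟨k, rfl⟩ := exists_add_of_le h
  have hk : k.degree = 0 := by rw [map_add] at hd; omega
  rw [Finsupp.degree_eq_zero_iff] at hk
  rw [hk, add_zero]

section MonomialIdeal

variable {K : Type*} [Field K] {W : Type*} {A : Set (W →₀ ℕ)} {u : W →₀ ℕ}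

theorem exists_le_of_coeff_ne_zero {f : MvPolynomial W K}
    (hf : f ∈ Ideal.span ((fun s => monomial s (1 : K)) '' A)) {n : W →₀ ℕ}
    (hn : coeff n f ≠ 0) : ∃ a ∈ A, a ≤ n :=
  mem_ideal_span_monomial_image.1 hf n (mem_support_iff.2 hn)

theorem coeff_mul_of_degree_eq (hdeg : ∀ a ∈ A, a.degree = u.degree) {f : MvPolynomial W K}
    (hf : f ∈ Ideal.span ((fun s => monomial s (1 : K)) '' A)) (s : MvPolynomial W K) :
    coeff u (s * f) = coeff 0 s * coeff u f := by
  classical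
  rw [coeff_mul, Finset.sum_eq_single ((0 : W →₀ ℕ), u)]
  · rintro ⟨x, y⟩ hxy hne
    by_contra h
    obtain ⟨a, ha, hay⟩ := exists_le_of_coeff_ne_zero hf (right_ne_zero_of_mul h)
    rw [Finset.HasAntidiagonal.mem_antidiagonal] at hxy
    dsimp only at hxy hay
    have hyu : y ≤ u := hxy ▸ le_add_self
    have hau := Finsupp.eq_of_le_of_degree_le (hay.trans hyu) (hdeg a ha).ge
    have hy : y = u := le_antisymm hyu (hau ▸ hay)
    subst hy
    exact hne (by rw [add_eq_right.1 hxy])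
  · intro h
    simp at h

theorem coeff_single_add_mul_of_isHomogeneous_one {p q : W} (hpq : p ≠ q) (hup : u p = 0)
    (huq : u q = 0) (hdeg : ∀ a ∈ A, a.degree = u.degree)
    (hA : ∀ a ∈ A, a = u ∨ a p ≠ 0 ∧ a q ≠ 0) {f : MvPolynomial W K}
    (hf : f ∈ Ideal.span ((fun s => monomial s (1 : K)) '' A)) {r : MvPolynomial W K}
    (hr : r.IsHomogeneous 1) (j : W) :
    coeff (Finsupp.single j 1 + u) (r * f) = coeff (Finsupp.single j 1) r * coeff u f := by
  classical
  rw [coeff_mul, Finset.sum_eq_single (Finsupp.single j 1, u)]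
  · rintro ⟨x, y⟩ hxy hne
    by_contra h
    obtain ⟨a, ha, hay⟩ := exists_le_of_coeff_ne_zero hf (right_ne_zero_of_mul h)
    rw [Finset.HasAntidiagonal.mem_antidiagonal] at hxy
    dsimp only at hxy hay
    have hx : x.degree = 1 := by
      by_contra hx
      exact left_ne_zero_of_mul h (hr.coeff_eq_zero hx)
    have hd := congrArg Finsupp.degree hxy
    simp only [map_add, Finsupp.degree_single, hx] at hd
    obtain rfl := Finsupp.eq_of_le_of_degree_le hay (by rw [hdeg a ha]; omega)
    rcases hA a ha with rfl | ⟨hp, hq⟩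
    · exact hne (by rw [add_right_cancel hxy])
    · have h1 := DFunLike.congr_fun hxy p
      have h2 := DFunLike.congr_fun hxy q
      simp only [Finsupp.add_apply, hup, huq, Finsupp.single_apply] at h1 h2
      have hjp : j = p := by
        by_contra hj; rw [if_neg hj] at h1; omega
      have hjq : j = q := by
        by_contra hj; rw [if_neg hj] at h2; omega
      exact hpq (hjp.symm.trans hjq)
  · intro h
    simp at h

/-- Let `I` be generated by monomials of one degree, one of which, `x^u`, involves neither of two
variables that both divide each of the other generators. A relation `x^m x^u = x^m' x^v` with
another generator `x^v` is then not a combination of linear syzygies. -/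
theorem not_syzygyModule_le_span_linear {p q : W} (hpq : p ≠ q) (hup : u p = 0)
    (huq : u q = 0) (hu : u ∈ A) (hdeg : ∀ a ∈ A, a.degree = u.degree)
    (hA : ∀ a ∈ A, a = u ∨ a p ≠ 0 ∧ a q ≠ 0) {v m m' : W →₀ ℕ} (hv : v ∈ A)
    (huv : m + u = m' + v) (hm : ¬ m' ≤ m) {b : ℕ} {f : Fin b → MvPolynomial W K}
    (hf : Ideal.span (Set.range f) = Ideal.span ((fun s => monomial s (1 : K)) '' A)) :
    ¬ syzygyModule f ≤ Submodule.span (MvPolynomial W K)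
      {r | r ∈ syzygyModule f ∧ ∀ i, (r i).IsHomogeneous 1} := by
  classical
  intro hle
  have hfI : ∀ i, f i ∈ Ideal.span ((fun s => monomial s (1 : K)) '' A) := fun i =>
    hf ▸ Ideal.subset_span ⟨i, rfl⟩
  let L : (Fin b → MvPolynomial W K) →ₗ[MvPolynomial W K] MvPolynomial W K :=
    Fintype.linearCombination _ fun i => C (coeff u (f i))
  have hL : ∀ r, L r = ∑ i, r i * C (coeff u (f i)) := fun r => rfl
  have hker : syzygyModule f ≤ LinearMap.ker L := by
    refine hle.trans (Submodule.span_le.2 ?_)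
    rintro r ⟨hr, hlin⟩
    have hr0 : ∑ i, r i * f i = 0 := hr
    have hhom : (L r).IsHomogeneous 1 := by
      rw [hL]
      exact IsHomogeneous.sum _ _ _ fun i _ => (hlin i).mul (isHomogeneous_C W _)
    change L r = 0
    ext n
    rw [coeff_zero]
    by_contra hn
    have hn1 : n.degree = 1 := by
      by_contra h
      exact hn (hhom.coeff_eq_zero h)
    obtain ⟨j, rfl⟩ := Finsupp.exists_eq_single_of_degree_eq_one hn1
    apply hn
    rw [hL, coeff_sum, ← coeff_zero (Finsupp.single j 1 + u), ← hr0, coeff_sum]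
    refine Finset.sum_congr rfl fun i _ => ?_
    rw [mul_comm, coeff_C_mul, mul_comm,
      coeff_single_add_mul_of_isHomogeneous_one hpq hup huq hdeg hA (hfI i) (hlin i)]
  have hmem : ∀ a ∈ A, ∃ s : Fin b → MvPolynomial W K, ∑ i, s i * f i = monomial a 1 := by
    intro a ha
    have : monomial a (1 : K) ∈ Ideal.span (Set.range f) :=
      hf ▸ Ideal.subset_span ⟨a, ha, rfl⟩
    exact (Submodule.mem_span_range_iff_exists_fun _).1 this
  obtain ⟨s, hs⟩ := hmem u hu
  obtain ⟨t, ht⟩ := hmem v hv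
  have hsyz : (monomial m (1 : K) • s - monomial m' (1 : K) • t) ∈ LinearMap.ker L := by
    apply hker
    change ∑ i, (monomial m (1 : K) * s i - monomial m' (1 : K) * t i) * f i = 0
    simp only [sub_mul, mul_assoc, Finset.sum_sub_distrib, ← Finset.mul_sum, hs, ht,
      monomial_mul, huv, sub_self]
  rw [LinearMap.mem_ker, map_sub, map_smul, map_smul, smul_eq_mul, smul_eq_mul] at hsyz
  have h1 := congrArg (coeff m) hsyz
  rw [coeff_sub, coeff_monomial_mul', coeff_monomial_mul', if_pos le_rfl, if_neg hm, sub_zero,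
    one_mul, coeff_zero, tsub_self, hL, coeff_sum] at h1
  have h2 := congrArg (coeff u) hs
  rw [coeff_sum, coeff_monomial, if_pos rfl] at h2
  simp only [coeff_mul_of_degree_eq hdeg (hfI _)] at h2
  simp only [mul_comm _ (C _), coeff_C_mul, mul_comm (coeff u _)] at h1
  exact zero_ne_one (h1.symm.trans h2)

end MonomialIdeal

theorem IsLinearlyRelated.exists_syzygyModule_le {K : Type*} [Field K] {W : Type*}
    {I : Ideal (MvPolynomial W K)} (h : IsLinearlyRelated I) :
    ∃ (b : ℕ) (f : Fin b → MvPolynomial W K), Ideal.span (Set.range f) = I ∧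
      syzygyModule f ≤ Submodule.span (MvPolynomial W K)
        {r | r ∈ syzygyModule f ∧ ∀ i, (r i).IsHomogeneous 1} := by
  obtain ⟨_, b, f, _, _, hf, hr⟩ := h
  exact ⟨b, f, hf, hr.ge⟩

theorem HasLinearResolution.exists_syzygyModule_le {K : Type*} [Field K] {W : Type*}
    {I : Ideal (MvPolynomial W K)} (h : HasLinearResolution I) :
    ∃ (b : ℕ) (f : Fin b → MvPolynomial W K), Ideal.span (Set.range f) = I ∧
      syzygyModule f ≤ Submodule.span (MvPolynomial W K)
        {r | r ∈ syzygyModule f ∧ ∀ i, (r i).IsHomogeneous 1} := by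
  obtain ⟨_, b, f, A, _, hA, hf, hex, _⟩ := h
  refine ⟨b 0, f, hf, fun r hr => ?_⟩
  obtain ⟨x, rfl⟩ := (hex r).1 hr
  rw [Matrix.mulVecLin_apply, Matrix.mulVec_eq_sum]
  refine Submodule.sum_mem _ fun j _ => ?_
  rw [op_smul_eq_smul]
  refine Submodule.smul_mem _ _ (Submodule.subset_span ⟨?_, fun i => hA 0 i j⟩)
  refine (hex _).2 ⟨Pi.single j 1, ?_⟩
  rw [Matrix.mulVecLin_apply, Matrix.mulVec_single_one]
  rfl

/-- The exponent of the monomial `x_e`. -/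
noncomputable def edgeExponent {W : Type*} (e : Sym2 W) : W →₀ ℕ :=
  Sym2.lift ⟨fun i j => Finsupp.single i 1 + Finsupp.single j 1, fun _ _ => add_comm _ _⟩ e

theorem edgeExponent_mk {W : Type*} (i j : W) :
    edgeExponent s(i, j) = Finsupp.single i 1 + Finsupp.single j 1 := rfl

theorem edgeMonomial_eq_monomial (K : Type*) [CommSemiring K] {W : Type*} (e : Sym2 W) :
    edgeMonomial K e = monomial (edgeExponent e) 1 := by
  induction e with
  | h i j =>
    rw [edgeExponent_mk, ← mul_one (1 : K), ← monomial_mul]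
    rfl

theorem matchingMonomial_eq_monomial (K : Type*) [CommSemiring K] {W : Type*}
    (M : Finset (Sym2 W)) :
    matchingMonomial K M = monomial (∑ e ∈ M, edgeExponent e) 1 := by
  rw [matchingMonomial, monomial_sum_one]
  exact Finset.prod_congr rfl fun e _ => edgeMonomial_eq_monomial K e

theorem degree_edgeExponent {W : Type*} (e : Sym2 W) : (edgeExponent e).degree = 2 := by
  induction e with
  | h i j => rw [edgeExponent_mk, map_add, Finsupp.degree_single, Finsupp.degree_single]

theorem edgeExponent_apply_ne_zero {W : Type*} {e : Sym2 W} {v : W} :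
    edgeExponent e v ≠ 0 ↔ v ∈ e := by
  classical
  induction e with
  | h i j =>
    rw [edgeExponent_mk, Finsupp.add_apply, Finsupp.single_apply, Finsupp.single_apply,
      Sym2.mem_iff]
    split_ifs <;> grind

theorem edgeExponent_apply_le_one {W : Type*} {e : Sym2 W} (he : ¬ e.IsDiag) (v : W) :
    edgeExponent e v ≤ 1 := by
  classical
  induction e with
  | h i j =>
    rw [Sym2.mk_isDiag_iff] at he
    rw [edgeExponent_mk, Finsupp.add_apply, Finsupp.single_apply, Finsupp.single_apply]
    split_ifs <;> grind

theorem degree_sum_edgeExponent {W : Type*} (M : Finset (Sym2 W)) :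
    (∑ e ∈ M, edgeExponent e).degree = M.card * 2 := by
  rw [map_sum, Finset.sum_congr rfl fun e _ => degree_edgeExponent e, Finset.sum_const,
    smul_eq_mul]

theorem sum_edgeExponent_apply_ne_zero {W : Type*} {M : Finset (Sym2 W)} {v : W} :
    (∑ e ∈ M, edgeExponent e) v ≠ 0 ↔ ∃ e ∈ M, v ∈ e := by
  simp [Finsupp.finsetSum_apply, Finset.sum_eq_zero_iff, ← edgeExponent_apply_ne_zero]

theorem SimpleGraph.IsKMatching.sum_edgeExponent_apply_le_one {W : Type*} {G : SimpleGraph W}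
    {k : ℕ} {M : Finset (Sym2 W)} (hM : G.IsKMatching k M) (v : W) :
    (∑ e ∈ M, edgeExponent e) v ≤ 1 := by
  by_cases h : ∃ e ∈ M, v ∈ e
  · obtain ⟨e, he, hv⟩ := h
    rw [Finsupp.finsetSum_apply, Finset.sum_eq_single e]
    · exact edgeExponent_apply_le_one (G.not_isDiag_of_mem_edgeSet (hM.isEdge e he)) v
    · intro e' he' hne
      by_contra h0
      exact hM.disjoint e he e' he' hne.symm v hv (edgeExponent_apply_ne_zero.1 h0)
    · exact fun h => absurd he h
  · rw [← sum_edgeExponent_apply_ne_zero, not_not] at h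
    omega

theorem squarefreePower_eq_span_monomial (K : Type*) [CommSemiring K] {W : Type*}
    (G : SimpleGraph W) (k : ℕ) :
    squarefreePower K G k = Ideal.span ((fun s => monomial s (1 : K)) ''
      {a | ∃ M, G.IsKMatching k M ∧ a = ∑ e ∈ M, edgeExponent e}) := by
  rw [squarefreePower]
  congr 1
  ext m
  constructor
  · rintro ⟨M, hM, rfl⟩
    exact ⟨_, ⟨M, hM, rfl⟩, (matchingMonomial_eq_monomial K M).symm⟩
  · rintro ⟨_, ⟨M, hM, rfl⟩, rfl⟩
    exact ⟨M, hM, (matchingMonomial_eq_monomial K M).symm⟩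

namespace SimpleGraph

variable {V W : Type*} {H : SimpleGraph V} {G : SimpleGraph W}

/-- The whisker at `v`, as an edge of a graph isomorphic to `H.whiskering`. -/
def whisker (φ : G ≃g H.whiskering) (v : V) : Sym2 W :=
  s(φ.symm (Sum.inl v), φ.symm (Sum.inr v))

theorem mem_whisker (φ : G ≃g H.whiskering) {v : V} {x : W} :
    x ∈ whisker φ v ↔ φ x = Sum.inl v ∨ φ x = Sum.inr v := by
  rw [whisker, Sym2.mem_iff]
  constructor
  · rintro (rfl | rfl) <;> simp
  · rintro (h | h) <;> simp [← h]

theorem whisker_mem_edgeSet (φ : G ≃g H.whiskering) (v : V) : whisker φ v ∈ G.edgeSet := by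
  rw [whisker, mem_edgeSet, φ.symm.map_adj_iff]
  rfl

theorem eq_of_mem_whisker (φ : G ≃g H.whiskering) {v w : V} {x : W} (hv : x ∈ whisker φ v)
    (hw : x ∈ whisker φ w) : v = w := by
  rw [mem_whisker] at hv hw
  grind

theorem exists_mem_whisker (φ : G ≃g H.whiskering) (x : W) : ∃ v, x ∈ whisker φ v := by
  simp only [mem_whisker]
  rcases φ x with v | v
  · exact ⟨v, Or.inl rfl⟩
  · exact ⟨v, Or.inr rfl⟩

theorem whisker_injective (φ : G ≃g H.whiskering) : Function.Injective (whisker φ) :=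
  fun _ _ h => eq_of_mem_whisker φ (Sym2.mem_mk_left _ _) (h ▸ Sym2.mem_mk_left _ _)

theorem isKMatching_whiskers (φ : G ≃g H.whiskering) (s : Finset V) :
    G.IsKMatching s.card (s.map ⟨whisker φ, whisker_injective φ⟩) where
  isEdge e he := by
    obtain ⟨v, -, rfl⟩ := Finset.mem_map.1 he
    exact whisker_mem_edgeSet φ v
  disjoint e he e' he' hne x hx hx' := by
    obtain ⟨v, -, rfl⟩ := Finset.mem_map.1 he
    obtain ⟨w, -, rfl⟩ := Finset.mem_map.1 he'
    exact hne (congrArg (whisker φ) (eq_of_mem_whisker φ hx hx'))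
  card_eq := Finset.card_map _

/-- The whisker at an isolated vertex is an isolated edge. -/
theorem eq_whisker_of_mem (φ : G ≃g H.whiskering) {v : V} (hv : ∀ w, ¬ H.Adj v w) {x : W}
    (hx : x ∈ whisker φ v) {e : Sym2 W} (he : e ∈ G.edgeSet) (hxe : x ∈ e) :
    e = whisker φ v := by
  obtain ⟨y, rfl⟩ := Sym2.mem_iff_exists.1 hxe
  rw [mem_edgeSet, ← φ.map_adj_iff] at he
  have hy : y = φ.symm (φ y) := by simp
  have hx' : x = φ.symm (φ x) := by simp
  rw [mem_whisker] at hx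
  rw [hx', hy, whisker]
  rcases hx with h | h <;> rw [h] at he ⊢ <;> rcases hφ : φ y with w | w <;> rw [hφ] at he
  · exact absurd he (hv w)
  · obtain rfl : v = w := he
    rfl
  · obtain rfl : v = w := he
    exact Sym2.eq_swap
  · exact he.elim

/-- If `H` has an isolated vertex and at least one more vertex, then the first syzygies of the
penultimate squarefree power of its whiskering are not generated by linear ones. -/
theorem not_exists_syzygyModule_le_whiskering (K : Type*) [Field K] [Fintype V]
    (φ : G ≃g H.whiskering) {p a : V} (hp : ∀ w, ¬ H.Adj p w) (hap : a ≠ p) :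
    ¬ ∃ (b : ℕ) (f : Fin b → MvPolynomial W K),
      Ideal.span (Set.range f) = squarefreePower K G (Fintype.card V - 1) ∧
      syzygyModule f ≤ Submodule.span (MvPolynomial W K)
        {r | r ∈ syzygyModule f ∧ ∀ i, (r i).IsHomogeneous 1} := by
  classical
  rintro ⟨b, f, hf, hle⟩
  rw [squarefreePower_eq_span_monomial] at hf
  have hmatch : ∀ v : V, G.IsKMatching (Fintype.card V - 1)
      ((Finset.univ.erase v).map ⟨whisker φ, whisker_injective φ⟩) := fun v => by
    have h := isKMatching_whiskers φ (Finset.univ.erase v)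
    rwa [Finset.card_erase_of_mem (Finset.mem_univ v), Finset.card_univ] at h
  have hadd : ∀ v : V, edgeExponent (whisker φ v) +
      ∑ e ∈ (Finset.univ.erase v).map ⟨whisker φ, whisker_injective φ⟩, edgeExponent e =
      ∑ w, edgeExponent (whisker φ w) := fun v => by
    rw [Finset.sum_map]
    exact Finset.add_sum_erase _ (fun w => edgeExponent (whisker φ w)) (Finset.mem_univ v)
  have hcover : ∀ v : V, ∀ x : W,
      (∑ e ∈ (Finset.univ.erase v).map ⟨whisker φ, whisker_injective φ⟩, edgeExponent e) x ≠ 0 ↔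
        x ∉ whisker φ v := fun v x => by
    rw [sum_edgeExponent_apply_ne_zero]
    constructor
    · rintro ⟨e, he, hxe⟩ hx
      obtain ⟨w, hw, rfl⟩ := Finset.mem_map.1 he
      exact (Finset.mem_erase.1 hw).1 (eq_of_mem_whisker φ hxe hx)
    · intro hx
      obtain ⟨w, hw⟩ := exists_mem_whisker φ x
      refine ⟨_, Finset.mem_map.2 ⟨w, Finset.mem_erase.2 ⟨?_, Finset.mem_univ w⟩, rfl⟩, hw⟩
      rintro rfl
      exact hx hw
  have hl : φ.symm (Sum.inl p) ∈ whisker φ p := Sym2.mem_mk_left _ _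
  have hr : φ.symm (Sum.inr p) ∈ whisker φ p := Sym2.mem_mk_right _ _
  refine not_syzygyModule_le_span_linear (A := {a | ∃ M, G.IsKMatching (Fintype.card V - 1) M ∧
      a = ∑ e ∈ M, edgeExponent e}) (p := φ.symm (Sum.inl p)) (q := φ.symm (Sum.inr p))
    (by simp) (not_not.1 fun h => (hcover p _).1 h hl) (not_not.1 fun h => (hcover p _).1 h hr)
    ⟨_, hmatch p, rfl⟩ ?_ ?_ ⟨_, hmatch a, rfl⟩ ((hadd p).trans (hadd a).symm) ?_ hf hle
  · rintro _ ⟨M, hM, rfl⟩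
    rw [degree_sum_edgeExponent, degree_sum_edgeExponent, hM.card_eq, (hmatch p).card_eq]
  · rintro _ ⟨M, hM, rfl⟩
    by_cases h : whisker φ p ∈ M
    · exact Or.inr ⟨sum_edgeExponent_apply_ne_zero.2 ⟨_, h, hl⟩,
        sum_edgeExponent_apply_ne_zero.2 ⟨_, h, hr⟩⟩
    · refine Or.inl (Finsupp.eq_of_le_of_degree_le (fun x => ?_) ?_)
      · by_cases hx : x ∈ whisker φ p
        · refine (not_not.1 fun h0 => ?_ : (∑ e ∈ M, edgeExponent e) x = 0).le.trans (Nat.zero_le _)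
          obtain ⟨e, he, hxe⟩ := sum_edgeExponent_apply_ne_zero.1 h0
          exact h (eq_whisker_of_mem φ hp hx (hM.isEdge e he) hxe ▸ he)
        · exact (hM.sum_edgeExponent_apply_le_one x).trans
            (Nat.one_le_iff_ne_zero.2 ((hcover p x).2 hx))
      · rw [degree_sum_edgeExponent, degree_sum_edgeExponent, hM.card_eq, (hmatch p).card_eq]
  · intro h
    have ha : φ.symm (Sum.inl a) ∈ whisker φ a := Sym2.mem_mk_left _ _
    have h0 := edgeExponent_apply_ne_zero.2 ha
    have h1 := h (φ.symm (Sum.inl a))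
    have h2 : edgeExponent (whisker φ p) (φ.symm (Sum.inl a)) ≠ 0 := by omega
    exact hap (eq_of_mem_whisker φ ha (edgeExponent_apply_ne_zero.1 h2))

end SimpleGraph

/-- `H` is the disjoint union of a complete graph on `c - d` vertices and `d` isolated vertices, and
`G` arises from `H` by adding a whisker to each vertex. -/
theorem lemma2p2 {K : Type*} [Field K] (c d : ℕ) (hd : 1 ≤ d) (hdc : d < c)
    {V : Type*} (H : SimpleGraph V)
    (hH : Nonempty (H ≃g
      ((⊤ : SimpleGraph (Fin (c - d))) ⊕g (⊥ : SimpleGraph (Fin d)))))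
    {W : Type*} (G : SimpleGraph W) (hG : Nonempty (G ≃g H.whiskering)) :
    ¬ IsLinearlyRelated (squarefreePower K G (c - 1)) ∧
      ¬ HasLinearResolution (squarefreePower K G (c - 1)) := by
  obtain ⟨ψ⟩ := hH
  obtain ⟨φ⟩ := hG
  have : Fintype V := Fintype.ofEquiv _ ψ.symm.toEquiv
  have hcard : Fintype.card V = c := by
    rw [Fintype.card_congr ψ.toEquiv, Fintype.card_sum, Fintype.card_fin, Fintype.card_fin]
    omega
  have hp : ∀ w, ¬ H.Adj (ψ.symm (Sum.inr ⟨0, hd⟩)) w := by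
    intro w h
    rw [← ψ.map_adj_iff, RelIso.apply_symm_apply] at h
    rcases hw : ψ w with i | i <;> simp [hw] at h
  have hap : ψ.symm (Sum.inl ⟨0, by omega⟩) ≠ ψ.symm (Sum.inr ⟨0, hd⟩) := by simp
  have key := SimpleGraph.not_exists_syzygyModule_le_whiskering K φ hp hap
  rw [hcard] at key
  exact ⟨fun h => key h.exists_syzygyModule_le, fun h => key h.exists_syzygyModule_le⟩
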